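/- Throughout, a Lie group is a matrix Lie group, i.e. a closed subgroup $G$ of $\mathrm{GL}_n(\mathbb{R})$ for some $n$, with the induced topology. Its Lie algebra is $\mathcal{L}(G)=\{X\in \mathrm{M}_n(\mathbb{R}) : \exp(tX)\in G \text{ for all } t\in\mathbb{R}\}$. Put $\mathfrak{g}^{(0)}=\mathfrak{g}$ and let $\mathfrak{g}^{(k+1)}$ be the linear span of the matrices $[x,y]=xy-yx$ with $x,y\in\mathfrak{g}^{(k)}$. A connected Lie group $G$ is called solvable if $\mathcal{L}(G)^{(k)}=0$ for some $k$. A connected Lie group is called semisimple if it contains no nontrivial normal closed connected solvable subgroup. A representation of $G$ is a continuous homomorphism $\rho:G\to\mathrm{GL}_d(\mathbb{C})$. **Theorem.** Let $G$ be a connected semisimple Lie group and $\rho:G\to\mathrm{GL}_d(\mathbb{C})$ a representation of $G$. Then every $\rho(G)$-invariant subspace $V$ of $\mathbb{C}^d$ has a $\rho(G)$-invariant complement, i.e. there is a $\rho(G)$-invariant subspace $W$ of $\mathbb{C}^d$ with $\mathbb{C}^d=V\oplus W$. -/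

import Mathlib

open scoped Matrix

namespace MatrixLie

/-- A (matrix) Lie group: a closed subgroup of `GL_n(ℝ)`. -/
def IsLieGroup {n : ℕ} (G : Subgroup (GL (Fin n) ℝ)) : Prop :=
  IsClosed (G : Set (GL (Fin n) ℝ))

/-- The Lie algebra `𝓛(G) = {X ∈ M_n(ℝ) : exp(tX) ∈ G for all t ∈ ℝ}`, as a set of matrices. -/
def lieAlgebra {n : ℕ} (G : Subgroup (GL (Fin n) ℝ)) : Set (Matrix (Fin n) (Fin n) ℝ) :=
  {X | ∀ t : ℝ, ∃ g ∈ G, (g : Matrix (Fin n) (Fin n) ℝ) = NormedSpace.exp (t • X)}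

/-- The derived series `𝔤^(0) = 𝔤`, `𝔤^(k+1) = ⟨[x, y] : x, y ∈ 𝔤^(k)⟩` (linear span), where
`[x, y] = x * y - y * x`. -/
def lieDerivedSeries {n : ℕ} (𝔤 : Set (Matrix (Fin n) (Fin n) ℝ)) :
    ℕ → Set (Matrix (Fin n) (Fin n) ℝ)
  | 0 => 𝔤
  | k + 1 => (Submodule.span ℝ
      {z | ∃ x ∈ lieDerivedSeries 𝔤 k, ∃ y ∈ lieDerivedSeries 𝔤 k, z = x * y - y * x} :
      Submodule ℝ (Matrix (Fin n) (Fin n) ℝ))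

/-- Solvability of a (connected) Lie group: `𝓛(G)^(k) = 0` for some `k`. -/
def IsSolvableLie {n : ℕ} (G : Subgroup (GL (Fin n) ℝ)) : Prop :=
  ∃ k : ℕ, lieDerivedSeries (lieAlgebra G) k = {0}

/-- Semisimplicity of a (connected) Lie group: there is no nontrivial normal closed connected
solvable subgroup. -/
def IsSemisimple {n : ℕ} (G : Subgroup (GL (Fin n) ℝ)) : Prop :=
  ∀ N : Subgroup (GL (Fin n) ℝ), N ≤ G → (N.subgroupOf G).Normal →
    IsClosed (N : Set (GL (Fin n) ℝ)) → IsConnected (N : Set (GL (Fin n) ℝ)) →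
    IsSolvableLie N → N = ⊥

/-- The subspace `V` of `ℂ^d` is `ρ(G)`-invariant. -/
def IsInvariant {n d : ℕ} {G : Subgroup (GL (Fin n) ℝ)} (ρ : G →ₜ* GL (Fin d) ℂ)
    (V : Submodule ℂ (Fin d → ℂ)) : Prop :=
  ∀ g : G, ∀ v ∈ V, (ρ g : Matrix (Fin d) (Fin d) ℂ) *ᵥ v ∈ V

end MatrixLie

-- The graph `H` of `ρ` is a closed connected subgroup of the units of the product of the two matrix
-- algebras, and on `H` the representation is the restriction of an algebra homomorphism, the second
-- projection. Hence `ρ` never has to be differentiated: `H` has a Lie algebra 𝔥 of tangent vectors,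
-- which acts on `ℂ^d` through that projection, and `H` is generated by the exponentials of 𝔥.
--
-- Semisimplicity passes to 𝔥. An abelian ideal of 𝔥 exponentiates to a connected commutative group;
-- the closure of its image in `G` is normal, connected and solvable, hence trivial. Since `H`
-- projects injectively to `G`, the ideal is zero. So 𝔥 has trivial radical, and by Cartan's
-- criterion its Killing form is nondegenerate.
--
-- Weyl's theorem, deduced from Whitehead's first lemma by a Casimir operator, now gives a
-- real-linear 𝔥-equivariant projection onto `V`. Averaging over multiplication by `i` makes it
-- complex linear; it commutes with exponentials of 𝔥, hence with `H`, and its kernel is the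
-- complement.

attribute [local instance 100] LieRing.ofAssociativeRing

/-! ### Invariance of the Casimir tensor -/

section DualBasis

/-- For an operator that is skew with respect to a nondegenerate symmetric bilinear form, the
element `∑ bᵢ ⊗ bⁱ` attached to a basis and its dual basis is invariant. -/
theorem LinearMap.BilinForm.sum_dualBasis_skew {K U W ι : Type*} [Field K] [AddCommGroup U]
    [Module K U] [AddCommGroup W] [Module K W] [Fintype ι] [DecidableEq ι]
    (β : LinearMap.BilinForm K U) (hβ : β.Nondegenerate) (hs : β.IsSymm) (b : Module.Basis ι K U)
    (T : U →ₗ[K] U) (hT : ∀ x y, β (T x) y = -β x (T y)) (F : U →ₗ[K] U →ₗ[K] W) :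
    ∑ i, (F (T (b i)) (β.dualBasis hβ b i) + F (b i) (T (β.dualBasis hβ b i))) = 0 := by
  set c := β.dualBasis hβ b with hc
  have h1 : ∀ u, u = ∑ j, β u (c j) • b j := fun u => by
    conv_lhs => rw [← b.sum_repr u]
    refine Finset.sum_congr rfl fun j _ => ?_
    congr 1
    rw [← LinearMap.BilinForm.dualBasis_dualBasis hβ hs b,
      LinearMap.BilinForm.dualBasis_repr_apply]
  have h2 : ∀ u, u = ∑ j, β (b j) u • c j := fun u => by
    conv_lhs => rw [← c.sum_repr u]
    refine Finset.sum_congr rfl fun j _ => ?_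
    rw [hc, LinearMap.BilinForm.dualBasis_repr_apply, hs.eq]
  have e1 : ∀ i, F (T (b i)) (c i) = ∑ j, β (T (b i)) (c j) • F (b j) (c i) := fun i => by
    conv_lhs => rw [h1 (T (b i))]
    simp
  have e2 : ∀ i, F (b i) (T (c i)) = ∑ j, β (b j) (T (c i)) • F (b i) (c j) := fun i => by
    conv_lhs => rw [h2 (T (c i))]
    simp
  -- After the swap, `F (b i) (c j)` has coefficient `β (T (b j)) (c i) + β (b j) (T (c i))`, which
  -- skewness kills.
  rw [Finset.sum_add_distrib, Finset.sum_congr rfl fun i _ => e1 i,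
    Finset.sum_congr rfl fun i _ => e2 i, Finset.sum_comm, ← Finset.sum_add_distrib]
  refine Finset.sum_eq_zero fun i _ => ?_
  rw [← Finset.sum_add_distrib]
  refine Finset.sum_eq_zero fun j _ => ?_
  rw [hT, neg_smul, neg_add_cancel]

end DualBasis

/-! ### Perfectness of Killing Lie algebras -/

namespace LieAlgebra

variable {K L : Type*} [Field K] [LieRing L] [LieAlgebra K L] [FiniteDimensional K L]

/-- A Lie algebra with nondegenerate Killing form is perfect: a linear map killing all brackets
is zero. -/
theorem IsKilling.eq_zero_of_forall_lie [IsKilling K L] {N : Type*} [AddCommGroup N] [Module K N]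
    (f : L →ₗ[K] N) (hf : ∀ x y : L, f ⁅x, y⁆ = 0) : f = 0 := by
  ext u
  rw [LinearMap.zero_apply, ← Module.forall_dual_apply_eq_zero_iff K]
  intro φ
  have hnd := IsKilling.killingForm_nondegenerate K L
  -- The vector representing `φ ∘ f` is central by invariance of the form, so `ad z = 0` and `z` is
  -- Killing-orthogonal to everything.
  obtain ⟨z, hz⟩ : ∃ z, killingForm K L z = φ ∘ₗ f :=
    ⟨((killingForm K L).toDual hnd).symm (φ ∘ₗ f),
      LinearMap.ext fun v => by
        rw [← LinearMap.BilinForm.toDual_def hnd, LinearEquiv.apply_symm_apply]⟩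
  have h1 : ∀ x : L, ⁅z, x⁆ = 0 := fun x => by
    refine hnd.1 _ fun y => ?_
    rw [LieModule.traceForm_apply_lie_apply, hz]
    simp [hf]
  have h2 : z = 0 := by
    refine hnd.1 _ fun y => ?_
    have : ad K L z = 0 := LinearMap.ext h1
    rw [killingForm_apply_apply, this]
    simp
  have := LinearMap.congr_fun hz u
  rw [h2] at this
  simpa using this.symm

end LieAlgebra

/-! ### Whitehead's first lemma for irreducible modules -/

namespace LieModule

variable {K L N : Type*} [Field K] [CharZero K] [LieRing L] [LieAlgebra K L]
  [FiniteDimensional K L] [LieAlgebra.IsKilling K L]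
  [AddCommGroup N] [Module K N] [LieRingModule L N] [LieModule K L N] [FiniteDimensional K N]

/-- For an irreducible module over a semisimple Lie algebra, the trace form is nondegenerate on the
complement of the kernel of the representation. -/
theorem traceForm_nondegenerate_killingCompl_ker [LieModule.IsIrreducible K L N] :
    ((traceForm K L N).restrict
      (LieIdeal.killingCompl K L (LieModule.ker K L N)).toSubmodule).Nondegenerate := by
  set I := LieIdeal.killingCompl K L (LieModule.ker K L N) with hI
  have hcompl : IsCompl (LieModule.ker K L N) I := LieIdeal.isCompl_killingCompl _
  let J : LieIdeal K L := LieAlgebra.InvariantForm.orthogonal (traceForm K L N)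
    (traceForm_lieInvariant K L N) ⊤
  have hJ : ∀ x, x ∈ J ↔ ∀ y, traceForm K L N x y = 0 := fun x => by
    rw [LieAlgebra.InvariantForm.mem_orthogonal]
    simp only [LieSubmodule.mem_top, forall_true_left]
    exact forall_congr' fun y => by rw [traceForm_comm]
  -- Cartan: the trace form vanishes on its radical `J`, so `[J, J]` acts nilpotently and has a
  -- nonzero fixed vector. Such vectors form a submodule `T`, so by irreducibility `[J, J]` acts by
  -- zero.
  have hnil : IsNilpotent (LieAlgebra.derivedSeries K J 1) N := by
    refine isNilpotent_derivedSeries_of_traceForm_eq_zero ?_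
    ext ⟨x, hx⟩ y
    exact (hJ x).1 hx y
  have : Nontrivial N := LieModule.nontrivial_of_isIrreducible K L N
  let T : LieSubmodule K L N :=
    { carrier := {n | ∀ x ∈ J, ∀ y ∈ J, ⁅⁅x, y⁆, n⁆ = 0}
      add_mem' := fun ha hb x hx y hy => by rw [lie_add, ha x hx y hy, hb x hx y hy, add_zero]
      zero_mem' := fun x _ y _ => lie_zero _
      smul_mem' := fun c n hn x hx y hy => by rw [lie_smul, hn x hx y hy, smul_zero]
      lie_mem := by
        intro z n hn x hx y hy
        have e : ⁅⁅x, y⁆, z⁆ = ⁅⁅x, z⁆, y⁆ + ⁅x, ⁅y, z⁆⁆ := by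
          rw [lie_lie x y z, ← lie_skew y ⁅x, z⁆]; abel
        rw [leibniz_lie, hn x hx y hy, lie_zero, add_zero, e, add_lie,
          hn _ (lie_mem_left K L J x z hx) y hy, hn x hx _ (lie_mem_left K L J y z hy), add_zero] }
  have hT : T = ⊤ := by
    by_contra hne
    have hbot : T = ⊥ := (eq_bot_or_eq_top T).resolve_right hne
    have hmax : Nontrivial (maxTrivSubmodule K (LieAlgebra.derivedSeries K J 1) N) :=
      LieModule.nontrivial_max_triv_of_isNilpotent K _ N
    obtain ⟨⟨n, hn⟩, hn0⟩ := exists_ne (0 : maxTrivSubmodule K (LieAlgebra.derivedSeries K J 1) N)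
    rw [mem_maxTrivSubmodule] at hn
    refine hn0 (Subtype.ext ?_)
    have : n ∈ T := fun x hx y hy =>
      hn ⟨⁅(⟨x, hx⟩ : J), (⟨y, hy⟩ : J)⁆, LieSubmodule.lie_mem_lie (LieSubmodule.mem_top _)
        (LieSubmodule.mem_top _)⟩
    rw [hbot] at this
    exact this
  have hIJ : I ⊓ J = ⊥ := by
    have : IsLieAbelian (I ⊓ J : LieIdeal K L) := by
      rw [LieSubmodule.lie_abelian_iff_lie_self_eq_bot, LieSubmodule.lie_eq_bot_iff]
      rintro x ⟨hx, hx'⟩ y ⟨-, hy'⟩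
      have hk : ⁅x, y⁆ ∈ LieModule.ker K L N := by
        rw [LieModule.mem_ker]
        intro n
        have : n ∈ T := hT ▸ LieSubmodule.mem_top n
        exact this x hx' y hy'
      have : ⁅x, y⁆ ∈ LieModule.ker K L N ⊓ I := ⟨hk, lie_mem_left K L I x y hx⟩
      rw [hcompl.inf_eq_bot] at this
      exact this
    exact LieAlgebra.IsKilling.ideal_eq_bot_of_isLieAbelian _
  have key : ∀ x : I, (∀ y : I, traceForm K L N x y = 0) → x = 0 := by
    intro x hx
    have hxJ : (x : L) ∈ J := by
      rw [hJ]
      intro y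
      obtain ⟨u, hu, v, hv, rfl⟩ := (LieSubmodule.mem_sup _ _ y).1
        (hcompl.sup_eq_top ▸ LieSubmodule.mem_top y)
      have hu0 : toEnd K L N u = 0 := LinearMap.ext ((LieModule.mem_ker K L N u).1 hu)
      rw [map_add, hx ⟨v, hv⟩, add_zero, traceForm_apply_apply, hu0]
      simp
    have : (x : L) ∈ I ⊓ J := ⟨x.2, hxJ⟩
    rw [hIJ] at this
    exact Subtype.ext this
  exact ⟨key, fun x hx => key x fun y => by rw [traceForm_comm]; exact hx y⟩

/-- **Whitehead's first lemma** for irreducible modules. -/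
theorem exists_eq_lie_of_cocycle_of_isIrreducible [LieModule.IsIrreducible K L N]
    (f : L →ₗ[K] N) (hf : ∀ x y, f ⁅x, y⁆ = ⁅x, f y⁆ - ⁅y, f x⁆) :
    ∃ q, ∀ x, f x = ⁅x, q⁆ := by
  classical
  set I := LieIdeal.killingCompl K L (LieModule.ker K L N) with hI
  have hcompl : IsCompl (LieModule.ker K L N) I := LieIdeal.isCompl_killingCompl _
  -- For a trivial action `I = 0` and the Casimir operator vanishes; there a cocycle kills brackets,
  -- and perfectness applies.
  by_cases hker : LieModule.ker K L N = ⊤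
  · have h0 : ∀ (x : L) (n : N), ⁅x, n⁆ = 0 := fun x n =>
      (LieModule.mem_ker K L N x).1 (hker ▸ LieSubmodule.mem_top x) n
    have := LieAlgebra.IsKilling.eq_zero_of_forall_lie f fun x y => by rw [hf, h0, h0, sub_zero]
    exact ⟨0, fun x => by rw [this, lie_zero]; rfl⟩
  set β := (traceForm K L N).restrict I.toSubmodule with hβdef
  have hβ : β.Nondegenerate := traceForm_nondegenerate_killingCompl_ker
  have hsymm : β.IsSymm := ⟨fun x y => traceForm_comm K L N x y⟩
  let b := Module.finBasis K I
  let c := β.dualBasis hβ b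
  let T : L → I →ₗ[K] I := fun y => toEnd K L I y
  have hTval : ∀ y (u : I), ((T y u : I) : L) = ⁅y, (u : L)⁆ := fun y u => rfl
  have hT : ∀ y u v, β (T y u) v = -β u (T y v) := fun y u v =>
    traceForm_apply_lie_apply' K L N y u v
  -- The Casimir operator: equivariant, with trace `dim I ≠ 0`, hence invertible by Schur's
  -- argument.
  let Γ : Module.End K N := ∑ i, toEnd K L N (b i) * toEnd K L N (c i)
  have hΓ : ∀ n, Γ n = ∑ i, ⁅(b i : L), ⁅(c i : L), n⁆⁆ := fun n => by
    simp [Γ, LinearMap.sum_apply]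
  have hΓcomm : ∀ (y : L) n, ⁅y, Γ n⁆ = Γ ⁅y, n⁆ := by
    intro y n
    let F : I →ₗ[K] I →ₗ[K] N := LinearMap.mk₂ K (fun u v => ⁅(u : L), ⁅(v : L), n⁆⁆)
      (by simp) (by simp) (by simp) (by simp)
    have := β.sum_dualBasis_skew hβ hsymm b (T y) (hT y) F
    rw [hΓ, hΓ, lie_sum, ← sub_eq_zero, ← Finset.sum_sub_distrib, ← this]
    refine Finset.sum_congr rfl fun i _ => ?_
    simp only [F, LinearMap.mk₂_apply, hTval]
    change _ = ⁅⁅y, (b i : L)⁆, ⁅(c i : L), n⁆⁆ + ⁅(b i : L), ⁅⁅y, (c i : L)⁆, n⁆⁆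
    rw [leibniz_lie y (b i : L), leibniz_lie y (c i : L), lie_add]
    abel
  have htr : LinearMap.trace K N Γ = Module.finrank K I := by
    have : ∀ i, LinearMap.trace K N (toEnd K L N (b i) * toEnd K L N (c i)) = 1 := fun i => by
      have := LinearMap.BilinForm.apply_dualBasis_right hβ hsymm b i i
      rw [if_pos rfl] at this
      exact this
    simp only [Γ, map_sum, this]
    simp
  have hIpos : (Module.finrank K I : K) ≠ 0 := by
    rw [Nat.cast_ne_zero]
    intro h0
    have : Subsingleton I := Module.finrank_zero_iff.1 h0
    apply hker
    have hbot : I = ⊥ := (LieSubmodule.eq_bot_iff _).2 fun x hx =>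
      congrArg Subtype.val (Subsingleton.elim (⟨x, hx⟩ : I) 0)
    simpa [hbot] using hcompl.sup_eq_top
  let Z : LieSubmodule K L N :=
    { LinearMap.ker Γ with
      lie_mem := by
        intro x n hn
        change Γ n = 0 at hn
        change Γ ⁅x, n⁆ = 0
        rw [← hΓcomm, hn, lie_zero] }
  have hZ : Z = ⊥ := by
    by_contra h
    have : Z = ⊤ := (eq_bot_or_eq_top Z).resolve_left h
    apply hIpos
    rw [← htr]
    have : Γ = 0 := LinearMap.ext fun n => by
      have : n ∈ Z := this ▸ LieSubmodule.mem_top n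
      exact this
    rw [this, map_zero]
  have hinj : Function.Injective Γ := by
    rw [← LinearMap.ker_eq_bot]
    exact congrArg LieSubmodule.toSubmodule hZ
  -- The choice is forced: `f x = ⁅x, q⁆` would give `Γ q = ∑ ⁅b i, f (c i)⁆`.
  obtain ⟨q, hq⟩ := (LinearMap.injective_iff_surjective.1 hinj) (∑ i, ⁅(b i : L), f (c i)⁆)
  refine ⟨q, fun y => hinj ?_⟩
  rw [← hΓcomm, hq, hΓ, lie_sum]
  let F : I →ₗ[K] I →ₗ[K] N := LinearMap.mk₂ K (fun u v => ⁅(u : L), f v⁆)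
    (by simp) (by simp) (by simp) (by simp)
  have := β.sum_dualBasis_skew hβ hsymm b (T y) (hT y) F
  symm
  rw [← sub_eq_zero, ← Finset.sum_sub_distrib, ← this]
  refine Finset.sum_congr rfl fun i _ => ?_
  simp only [F, LinearMap.mk₂_apply, hTval]
  change _ = ⁅⁅y, (b i : L)⁆, f (c i)⁆ + ⁅(b i : L), f ⁅y, (c i : L)⁆⁆
  rw [leibniz_lie y (b i : L), hf, lie_sub]
  abel

end LieModule

/-! ### Whitehead's lemma in general and Weyl's theorem -/

namespace LieModule

variable {K L : Type*} [Field K] [CharZero K] [LieRing L] [LieAlgebra K L]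
  [FiniteDimensional K L] [LieAlgebra.IsKilling K L]

/-- Induction on dimension. Given a proper nonzero submodule, solve in the quotient and lift;
subtracting that coboundary leaves a cocycle with values in the submodule, where the induction
hypothesis applies again. -/
theorem exists_eq_lie_of_cocycle_of_finrank_eq (r : ℕ) : ∀ (N : Type*) [AddCommGroup N]
    [Module K N] [LieRingModule L N] [LieModule K L N] [FiniteDimensional K N],
    Module.finrank K N = r → ∀ f : L →ₗ[K] N, (∀ x y : L, f ⁅x, y⁆ = ⁅x, f y⁆ - ⁅y, f x⁆) →
    ∃ q, ∀ x : L, f x = ⁅x, q⁆ := by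
  induction r using Nat.strong_induction_on with
  | _ r ih =>
  intro N _ _ _ _ _ hr f hf
  rcases subsingleton_or_nontrivial N with hN | hN
  · exact ⟨0, fun x => Subsingleton.elim _ _⟩
  by_cases hirr : ∃ N' : LieSubmodule K L N, N' ≠ ⊥ ∧ N' ≠ ⊤
  swap
  · push Not at hirr
    have := LieModule.IsIrreducible.mk (R := K) (L := L) (M := N) hirr
    exact exists_eq_lie_of_cocycle_of_isIrreducible f hf
  obtain ⟨N', hbot, htop⟩ := hirr
  have hlt : Module.finrank K N' < r :=
    hr ▸ Submodule.finrank_lt fun h => htop ((LieSubmodule.toSubmodule_eq_top N').1 h)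
  have hpos : 0 < Module.finrank K N' := by
    have : Nontrivial N' := (LieSubmodule.nontrivial_iff_ne_bot K L N).2 hbot
    exact Module.finrank_pos
  have hlt' : Module.finrank K (N ⧸ N') < r := by
    have := N'.toSubmodule.finrank_quotient_add_finrank
    rw [hr] at this
    exact (Nat.lt_add_of_pos_right hpos).trans_eq this
  let π : N →ₗ⁅K, L⁆ N ⧸ N' := LieSubmodule.Quotient.mk' N'
  obtain ⟨q', hq'⟩ := ih _ hlt' (N ⧸ N') rfl ((π : N →ₗ[K] N ⧸ N') ∘ₗ f) fun x y => by
    change π (f ⁅x, y⁆) = ⁅x, π (f y)⁆ - ⁅y, π (f x)⁆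
    rw [hf, map_sub, LieModuleHom.map_lie, LieModuleHom.map_lie]
  obtain ⟨q, rfl⟩ := LieSubmodule.Quotient.surjective_mk' N' q'
  let g : L →ₗ[K] N := f - (toEnd K L N : L →ₗ[K] Module.End K N).flip q
  have hg : ∀ x, g x = f x - ⁅x, q⁆ := fun x => rfl
  have hgN : ∀ x, g x ∈ N' := fun x => by
    rw [← LieSubmodule.Quotient.mk_eq_zero', hg]
    have := hq' x
    change π (f x - ⁅x, q⁆) = 0
    rw [map_sub, LieModuleHom.map_lie, sub_eq_zero]
    exact this
  obtain ⟨p, hp⟩ := ih _ hlt N' rfl (g.codRestrict N'.toSubmodule hgN) fun x y => by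
    apply Subtype.ext
    change g ⁅x, y⁆ = ⁅x, g y⁆ - ⁅y, g x⁆
    rw [hg, hg, hg, hf, lie_sub, lie_sub, lie_lie]
    abel
  refine ⟨q + p, fun x => ?_⟩
  have : g x = ⁅x, (p : N)⁆ := congrArg Subtype.val (hp x)
  rw [lie_add, ← this, hg]
  abel

/-- **Whitehead's first lemma**: every `1`-cocycle of a semisimple Lie algebra with values in a
finite-dimensional module is a coboundary. -/
theorem exists_eq_lie_of_cocycle {N : Type*} [AddCommGroup N]
    [Module K N] [LieRingModule L N] [LieModule K L N] [FiniteDimensional K N]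
    (f : L →ₗ[K] N) (hf : ∀ x y : L, f ⁅x, y⁆ = ⁅x, f y⁆ - ⁅y, f x⁆) :
    ∃ q, ∀ x : L, f x = ⁅x, q⁆ :=
  exists_eq_lie_of_cocycle_of_finrank_eq _ N rfl f hf

/-- **Weyl's theorem on complete reducibility**: every submodule is the image of an equivariant
projection. -/
theorem exists_equivariant_projection {M : Type*} [AddCommGroup M]
    [Module K M] [LieRingModule L M] [LieModule K L M] [FiniteDimensional K M]
    (V : LieSubmodule K L M) :
    ∃ P : M →ₗ[K] M, (∀ (x : L) m, P ⁅x, m⁆ = ⁅x, P m⁆) ∧ (∀ m, P m ∈ V) ∧ ∀ v ∈ V, P v = v := by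
  obtain ⟨p', hp'⟩ := V.toSubmodule.subtype.exists_leftInverse_of_injective
    V.toSubmodule.ker_subtype
  let p : Module.End K M := V.toSubmodule.subtype ∘ₗ p'
  have hpV : ∀ m, p m ∈ V := fun m => (p' m).2
  have hpv : ∀ v ∈ V, p v = v := fun v hv =>
    congrArg Subtype.val (LinearMap.congr_fun hp' ⟨v, hv⟩)
  -- Differences of projections onto `V` lie in `N`, and so does every `⁅x, p⁆`. Writing this
  -- cocycle as `⁅x, q⁆` with `q ∈ N` makes `p - q` an equivariant projection onto `V`.
  let N : LieSubmodule K L (Module.End K M) :=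
    { carrier := {φ | (∀ m, φ m ∈ V) ∧ ∀ v ∈ V, φ v = 0}
      add_mem' := fun ha hb => ⟨fun m => V.add_mem (ha.1 m) (hb.1 m), fun v hv => by
        rw [LinearMap.add_apply, ha.2 v hv, hb.2 v hv, add_zero]⟩
      zero_mem' := ⟨fun m => V.zero_mem, fun v _ => rfl⟩
      smul_mem' := fun c φ h => ⟨fun m => V.smul_mem c (h.1 m), fun v hv => by
        rw [LinearMap.smul_apply, h.2 v hv, smul_zero]⟩
      lie_mem := fun {x φ} h => ⟨fun m => by
        rw [LieHom.lie_apply]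
        exact V.sub_mem (V.lie_mem (h.1 m)) (h.1 _), fun v hv => by
        rw [LieHom.lie_apply, h.2 v hv, h.2 _ (V.lie_mem hv), lie_zero, sub_zero]⟩ }
  let f : L →ₗ[K] N := LinearMap.codRestrict N.toSubmodule
    ((toEnd K L (Module.End K M) : L →ₗ[K] Module.End K (Module.End K M)).flip p) fun x => by
      change ⁅x, p⁆ ∈ N
      refine ⟨fun m => ?_, fun v hv => ?_⟩
      · rw [LieHom.lie_apply]
        exact V.sub_mem (V.lie_mem (hpV m)) (hpV _)
      · rw [LieHom.lie_apply, hpv v hv, hpv _ (V.lie_mem hv), sub_self]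
  obtain ⟨q, hq⟩ := exists_eq_lie_of_cocycle f fun x y => by
    apply Subtype.ext
    exact lie_lie x y p
  have hq' : ∀ x : L, ⁅x, p⁆ = ⁅x, (q : Module.End K M)⁆ := fun x => congrArg Subtype.val (hq x)
  refine ⟨p - q, fun x m => ?_, fun m => V.sub_mem (hpV m) (q.2.1 m), fun v hv => ?_⟩
  · have := LinearMap.congr_fun (hq' x) m
    rw [LieHom.lie_apply, LieHom.lie_apply] at this
    rw [LinearMap.sub_apply, LinearMap.sub_apply, lie_sub]
    rw [← sub_eq_zero, ← neg_eq_zero, ← sub_eq_zero.2 this]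
    abel
  · rw [LinearMap.sub_apply, hpv v hv, q.2.2 v hv, sub_zero]

end LieModule

/-! ### Exponentials as units -/

namespace NormedSpace

open Filter Topology

variable {A : Type*} [NormedRing A] [NormedAlgebra ℝ A] [CompleteSpace A]

theorem continuous_exp_real : Continuous (exp : A → A) :=
  letI := NormedAlgebra.restrictScalars ℚ ℝ A
  exp_continuous

theorem exp_add_of_commute_real {x y : A} (h : Commute x y) : exp (x + y) = exp x * exp y :=
  letI := NormedAlgebra.restrictScalars ℚ ℝ A
  exp_add_of_commute h

/-- The exponential of an element of a real Banach algebra, as a unit. -/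
noncomputable def expUnits (x : A) : Aˣ where
  val := exp x
  inv := exp (-x)
  val_inv := by
    rw [← exp_add_of_commute_real ((Commute.refl x).neg_right), add_neg_cancel, exp_zero]
  inv_val := by
    rw [← exp_add_of_commute_real ((Commute.refl x).neg_left), neg_add_cancel, exp_zero]

@[simp]
theorem val_expUnits (x : A) : (expUnits x : A) = exp x := rfl

theorem expUnits_add {x y : A} (h : Commute x y) : expUnits (x + y) = expUnits x * expUnits y :=
  Units.ext (exp_add_of_commute_real h)

@[simp]
theorem expUnits_zero : expUnits (0 : A) = 1 := Units.ext exp_zero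

theorem expUnits_neg (x : A) : expUnits (-x) = (expUnits x)⁻¹ := Units.ext rfl

theorem expUnits_nsmul (n : ℕ) (x : A) : expUnits (n • x) = expUnits x ^ n := by
  induction n with
  | zero => simp
  | succ n ih => rw [succ_nsmul, expUnits_add ((Commute.refl x).smul_left n), ih, pow_succ]

theorem expUnits_zsmul (n : ℤ) (x : A) : expUnits (n • x) = expUnits x ^ n := by
  cases n with
  | ofNat n => simpa using expUnits_nsmul n x
  | negSucc n => rw [negSucc_zsmul, expUnits_neg, expUnits_nsmul, zpow_negSucc]

theorem expUnits_conj (u : Aˣ) (x : A) : expUnits (u * x * ↑u⁻¹) = u * expUnits x * u⁻¹ :=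
  letI := NormedAlgebra.restrictScalars ℚ ℝ A
  Units.ext (exp_units_conj u x)

theorem continuous_expUnits : Continuous (expUnits : A → Aˣ) :=
  Units.continuous_iff.2 ⟨continuous_exp_real, continuous_exp_real.comp continuous_neg⟩

theorem hasStrictFDerivAt_exp_zero_equiv :
    HasStrictFDerivAt exp ((ContinuousLinearEquiv.refl ℝ A : A ≃L[ℝ] A) : A →L[ℝ] A) 0 :=
  hasStrictFDerivAt_exp_zero

/-- If a linear subspace is stable under `ad z`, then it is stable under conjugation by `exp z`. -/
theorem expUnits_conj_mem [FiniteDimensional ℝ A] {S : Submodule ℝ A} {z : A}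
    (hS : ∀ x ∈ S, z * x - x * z ∈ S) {x : A} (hx : x ∈ S) :
    (expUnits z : A) * x * ↑(expUnits z)⁻¹ ∈ S := by
  -- Conjugation by `exp z` is `exp (ad z)`, where `ad z = l + r` is a sum of commuting operators;
  -- its power series preserves the closed subspace `S`.
  let l : A →L[ℝ] A := ContinuousLinearMap.mul ℝ A z
  let r : A →L[ℝ] A := (ContinuousLinearMap.mul ℝ A).flip (-z)
  have hl : ∀ n y, (l ^ n) y = z ^ n * y := fun n y => by
    induction n with
    | zero => simp
    | succ n ih => rw [pow_succ', mul_apply_eq_comp, ih, pow_succ', mul_assoc]; rfl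
  have hr : ∀ n y, (r ^ n) y = y * (-z) ^ n := fun n y => by
    induction n with
    | zero => simp
    | succ n ih => rw [pow_succ', mul_apply_eq_comp, ih, pow_succ, ← mul_assoc]; rfl
  have hel : ∀ y, exp l y = exp z * y := fun y => by
    have h1 := (exp_series_hasSum_exp' (𝕂 := ℝ) l).mapL (ContinuousLinearMap.apply ℝ A y)
    have h2 := (exp_series_hasSum_exp' (𝕂 := ℝ) z).mul_right y
    refine h1.unique ?_
    convert! h2 using 2 with n
    simp [hl]
  have her : ∀ y, exp r y = y * exp (-z) := fun y => by
    have h1 := (exp_series_hasSum_exp' (𝕂 := ℝ) r).mapL (ContinuousLinearMap.apply ℝ A y)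
    have h2 := (exp_series_hasSum_exp' (𝕂 := ℝ) (-z)).mul_left y
    refine h1.unique ?_
    convert! h2 using 2 with n
    simp [hr]
  have hcomm : Commute l r := ContinuousLinearMap.ext fun y => (mul_assoc z y (-z)).symm
  have hval : exp (l + r) x = (expUnits z : A) * x * ↑(expUnits z)⁻¹ := by
    rw [exp_add_of_commute_real hcomm, mul_apply_eq_comp, her, hel, ← mul_assoc]
    rfl
  rw [← hval]
  have hpow : ∀ n : ℕ, ((l + r) ^ n) x ∈ S := fun n => by
    induction n with
    | zero => simpa using hx
    | succ n ih =>
      rw [pow_succ', mul_apply_eq_comp]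
      have := hS _ ih
      rw [sub_eq_add_neg, ← mul_neg] at this
      exact this
  have h1 := (exp_series_hasSum_exp' (𝕂 := ℝ) (l + r)).mapL (ContinuousLinearMap.apply ℝ A x)
  have hcl : IsClosed (S : Set A) := S.closed_of_finiteDimensional
  exact hcl.mem_of_tendsto h1 (Eventually.of_forall fun s => S.sum_mem fun n _ =>
    S.smul_mem _ (hpow n))

end NormedSpace

/-! ### Tangent spaces of closed subgroups -/

namespace Subgroup

open Filter Topology NormedSpace

variable {A : Type*} [NormedRing A] [NormedAlgebra ℝ A] [CompleteSpace A]

/-- The set of `x` whose one-parameter group `exp (t x)` lies in the subgroup `H`. -/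
def tangent (H : Subgroup Aˣ) : Set A := {x | ∀ t : ℝ, expUnits (t • x) ∈ H}

variable {H : Subgroup Aˣ}

theorem expUnits_mem_of_mem_tangent {x : A} (hx : x ∈ H.tangent) : expUnits x ∈ H := by
  simpa using hx 1

/-- The integer powers `expUnits (x i) ^ ⌊t / z i⌋` stay in `H` and converge to `expUnits (t • y)`,
because rounding costs at most `|z i|`. -/
theorem mem_tangent_of_tendsto (hH : IsClosed (H : Set Aˣ)) {ι : Type*} {l : Filter ι} [l.NeBot]
    {z : ι → ℝ} {x : ι → A} {y : A} (hz : Tendsto z l (𝓝 0)) (hz0 : ∀ᶠ i in l, z i ≠ 0)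
    (hx : ∀ᶠ i in l, expUnits (x i) ∈ H) (hy : Tendsto (fun i => (z i)⁻¹ • x i) l (𝓝 y)) :
    y ∈ H.tangent := by
  intro t
  have h1 : Tendsto (fun i => (⌊t / z i⌋ : ℝ) * z i) l (𝓝 t) := by
    rw [tendsto_iff_norm_sub_tendsto_zero]
    refine squeeze_zero' (Eventually.of_forall fun _ => norm_nonneg _) ?_ (by simpa using hz.norm)
    filter_upwards [hz0] with i hi
    have e : (⌊t / z i⌋ : ℝ) * z i - t = -(Int.fract (t / z i) * z i) := by
      rw [Int.fract]; field_simp; ring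
    rw [e, norm_neg, norm_mul]
    refine mul_le_of_le_one_left (norm_nonneg _) ?_
    rw [Real.norm_eq_abs, abs_of_nonneg (Int.fract_nonneg _)]
    exact (Int.fract_lt_one _).le
  have h2 : Tendsto (fun i => ⌊t / z i⌋ • x i) l (𝓝 (t • y)) := by
    refine (h1.smul hy).congr' ?_
    filter_upwards [hz0] with i hi
    rw [smul_smul, mul_assoc, mul_inv_cancel₀ hi, mul_one, Int.cast_smul_eq_zsmul]
  refine hH.mem_of_tendsto ((continuous_expUnits.tendsto _).comp h2) ?_
  filter_upwards [hx] with i hi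
  rw [Function.comp_apply, expUnits_zsmul]
  exact H.zpow_mem hi _

theorem smul_mem_tangent (c : ℝ) {x : A} (hx : x ∈ H.tangent) : c • x ∈ H.tangent := fun t => by
  rw [smul_smul]
  exact hx _

/-- The curve `log (exp (s x) exp (s y))` has derivative `x + y` at `0`, with `log` a local inverse
of `exp`. -/
theorem add_mem_tangent (hH : IsClosed (H : Set Aˣ)) {x y : A} (hx : x ∈ H.tangent)
    (hy : y ∈ H.tangent) : x + y ∈ H.tangent := by
  have he := hasStrictFDerivAt_exp_zero_equiv (A := A)
  let log : A → A := he.localInverse exp _ 0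
  have hlog : HasFDerivAt log (ContinuousLinearMap.id ℝ A) 1 := by
    simpa [log] using! he.to_localInverse.hasFDerivAt
  have hlog1 : log 1 = 0 := by
    have := he.localInverse_apply_image
    rwa [exp_zero] at this
  have hexplog : ∀ᶠ a in 𝓝 (1 : A), exp (log a) = a := by
    have := he.eventually_right_inverse
    rwa [exp_zero] at this
  let p : ℝ → A := fun s => exp (s • x) * exp (s • y)
  have hp0 : p 0 = 1 := by simp [p]
  have hp : HasDerivAt p (x + y) 0 := by
    have := (hasDerivAt_exp_smul_const x (0 : ℝ)).mul (hasDerivAt_exp_smul_const y (0 : ℝ))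
    simpa using! this
  have hq : HasDerivAt (log ∘ p) (x + y) 0 := by
    rw [← hp0] at hlog
    simpa using hlog.comp_hasDerivAt 0 hp
  rw [hasDerivAt_iff_tendsto_slope_zero] at hq
  have hpt : Tendsto p (𝓝[≠] 0) (𝓝 1) := by
    have := hp.continuousAt.tendsto.mono_left (nhdsWithin_le_nhds (s := {0}ᶜ))
    rwa [hp0] at this
  refine mem_tangent_of_tendsto hH (l := 𝓝[≠] (0 : ℝ)) (z := id) (x := log ∘ p)
    (tendsto_id.mono_left nhdsWithin_le_nhds) eventually_mem_nhdsWithin ?_ ?_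
  · filter_upwards [hpt.eventually hexplog] with s hs
    have : expUnits ((log ∘ p) s) = expUnits (s • x) * expUnits (s • y) := Units.ext hs
    rw [this]
    exact H.mul_mem (hx s) (hy s)
  · simpa [hp0, hlog1] using hq

theorem conj_mem_tangent {u : Aˣ} (hu : u ∈ H) {x : A} (hx : x ∈ H.tangent) :
    (u : A) * x * ↑u⁻¹ ∈ H.tangent := fun t => by
  have : t • ((u : A) * x * ↑u⁻¹) = u * (t • x) * ↑u⁻¹ := by simp
  rw [this, expUnits_conj]
  exact H.mul_mem (H.mul_mem hu (hx t)) (H.inv_mem hu)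

/-- The tangent space at the identity of a closed subgroup of the units. -/
def tangentSubmodule (H : Subgroup Aˣ) (hH : IsClosed (H : Set Aˣ)) : Submodule ℝ A where
  carrier := H.tangent
  add_mem' := add_mem_tangent hH
  zero_mem' := fun t => by simp
  smul_mem' := fun c _ => smul_mem_tangent c

theorem hasDerivAt_expUnits_conj (x y : A) :
    HasDerivAt (fun t : ℝ => (expUnits (t • x) : A) * y * ↑(expUnits (t • x))⁻¹)
      (x * y - y * x) 0 := by
  have h1 := (hasDerivAt_exp_smul_const x (0 : ℝ)).mul_const y
  have h2 := hasDerivAt_exp_smul_const (-x) (0 : ℝ)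
  have h := h1.mul h2
  simp only [smul_neg] at h
  simpa [sub_eq_add_neg] using! h

theorem _root_.HasDerivAt.mem_of_forall_mem {E : Type*} [NormedAddCommGroup E] [NormedSpace ℝ E]
    {S : Submodule ℝ E} (hS : IsClosed (S : Set E)) {γ : ℝ → E} {γ' : E} {a : ℝ}
    (h : HasDerivAt γ γ' a) (hγ : ∀ t, γ t ∈ S) : γ' ∈ S := by
  rw [hasDerivAt_iff_tendsto_slope_zero] at h
  exact hS.mem_of_tendsto h (Eventually.of_forall fun t => S.smul_mem _ (S.sub_mem (hγ _) (hγ _)))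

/-- The Lie algebra of a closed subgroup of the units of a finite-dimensional algebra. -/
def tangentLieSubalgebra [FiniteDimensional ℝ A] (H : Subgroup Aˣ) (hH : IsClosed (H : Set Aˣ)) :
    LieSubalgebra ℝ A :=
  { H.tangentSubmodule hH with
    lie_mem' := fun {x y} hx hy =>
      (hasDerivAt_expUnits_conj x y).mem_of_forall_mem
        (Submodule.closed_of_finiteDimensional (H.tangentSubmodule hH))
        fun t => conj_mem_tangent (hx t) hy }

/-- Near the origin, a subspace transverse to the tangent space contains no nonzero element whose
exponential lies in the subgroup. -/
theorem eventually_eq_zero_of_expUnits_mem [FiniteDimensional ℝ A] (hH : IsClosed (H : Set Aˣ))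
    {W : Submodule ℝ A} (hW : Disjoint (H.tangentSubmodule hH) W) :
    ∀ᶠ y : W in 𝓝 0, expUnits (y : A) ∈ H → y = 0 := by
  by_contra hcon
  obtain ⟨y, hy, hyH⟩ := exists_seq_forall_of_frequently (not_eventually.1 hcon)
  push Not at hyH
  have hpos : ∀ n, ‖y n‖ ≠ 0 := fun n => norm_ne_zero_iff.2 (hyH n).2
  -- By compactness the directions accumulate at a unit vector of `W`, which would be tangent to
  -- `H`.
  have hsph : ∀ n, ‖y n‖⁻¹ • y n ∈ Metric.sphere (0 : W) 1 := fun n => by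
    rw [mem_sphere_zero_iff_norm, norm_smul, norm_inv, norm_norm, inv_mul_cancel₀ (hpos n)]
  have : ProperSpace W := FiniteDimensional.proper ℝ W
  obtain ⟨w, hw, φ, hφ, hlim⟩ := (isCompact_sphere (0 : W) 1).tendsto_subseq hsph
  have hwT : (w : A) ∈ H.tangent := by
    refine mem_tangent_of_tendsto hH (z := fun n => ‖y (φ n)‖) (x := fun n => (y (φ n) : A))
      (by simpa using (hy.comp hφ.tendsto_atTop).norm) (Eventually.of_forall fun n => hpos _)
      (Eventually.of_forall fun n => (hyH _).1) ?_
    exact (continuous_subtype_val.tendsto w).comp hlim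
  have : (w : A) = 0 := Submodule.disjoint_def.1 hW w hwT w.2
  have hw0 : w = 0 := Subtype.ext this
  rw [hw0] at hw
  simp at hw

/-- A connected closed subgroup is generated by the exponentials of its tangent vectors. -/
theorem le_closure_expUnits_of_isPreconnected [FiniteDimensional ℝ A] (hH : IsClosed (H : Set Aˣ))
    (hconn : IsPreconnected (H : Set Aˣ)) : H ≤ closure (expUnits '' H.tangent) := by
  set Γ := closure (expUnits '' H.tangent) with hΓ
  have hΓH : Γ ≤ H := by
    rw [hΓ, closure_le]
    rintro _ ⟨x, hx, rfl⟩
    exact expUnits_mem_of_mem_tangent hx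
  obtain ⟨W, hW⟩ := (H.tangentSubmodule hH).exists_isCompl
  let e : (H.tangentSubmodule hH × W) ≃L[ℝ] A :=
    (Submodule.prodEquivOfIsCompl _ W hW).toContinuousLinearEquiv
  -- A chart at `1`: for points of `H` near `1` the transverse coordinate vanishes, so `Γ` is open
  -- in `H`, hence all of it.
  let Φ : H.tangentSubmodule hH × W → A := fun p => exp (p.1 : A) * exp (p.2 : A)
  have hΦ0 : Φ 0 = 1 := by simp [Φ]
  have hΦ : HasStrictFDerivAt Φ (e : (H.tangentSubmodule hH × W) →L[ℝ] A) 0 := by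
    have hexp := hasStrictFDerivAt_exp_zero (𝕂 := ℝ) (𝔸 := A)
    have hexp' : ∀ T : (H.tangentSubmodule hH × W) →L[ℝ] A,
        HasStrictFDerivAt (fun p => exp (T p)) T 0 := fun T => by
      rw [← map_zero T] at hexp
      exact hexp.comp 0 T.hasStrictFDerivAt
    have h1 := hexp' ((H.tangentSubmodule hH).subtypeL ∘L ContinuousLinearMap.fst ℝ _ W)
    have h2 := hexp' (W.subtypeL ∘L ContinuousLinearMap.snd ℝ _ W)
    refine (h1.mul' h2).congr_fderiv ?_
    ext p <;> simp [e]
  have hev : ∀ᶠ p in 𝓝 (0 : H.tangentSubmodule hH × W),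
      expUnits (p.2 : A) ∈ H → p.2 = 0 :=
    (continuous_snd.tendsto (0 : H.tangentSubmodule hH × W)).eventually
      (eventually_eq_zero_of_expUnits_mem hH hW.disjoint)
  have hnhds : ∀ᶠ a in 𝓝 (1 : A), ∃ p : H.tangentSubmodule hH × W,
      (expUnits (p.2 : A) ∈ H → p.2 = 0) ∧ Φ p = a := by
    rw [← hΦ0, ← hΦ.map_nhds_eq_of_equiv]
    exact Filter.mem_map.2 (hev.mono fun p hp => ⟨p, hp, rfl⟩)
  have hnhdsU : ∀ᶠ u in 𝓝 (1 : Aˣ), u ∈ H → u ∈ Γ := by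
    filter_upwards [(Units.continuous_val.tendsto (1 : Aˣ)).eventually hnhds] with u hu huH
    obtain ⟨⟨x, y⟩, hy, hxy⟩ := hu
    have hu' : u = expUnits (x : A) * expUnits (y : A) := Units.ext hxy.symm
    have hxΓ : expUnits (x : A) ∈ Γ := subset_closure ⟨x, x.2, rfl⟩
    have hy0 : y = 0 := hy ((H.mul_mem_cancel_left (hΓH hxΓ)).1 (hu' ▸ huH))
    rw [hu', hy0]
    simpa using hxΓ
  have hopen : IsOpen ((Γ.subgroupOf H : Subgroup H) : Set H) := by
    refine Subgroup.isOpen_of_mem_nhds _ (g := 1) ?_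
    filter_upwards [(continuous_subtype_val.tendsto (1 : H)).eventually hnhdsU] with u hu
    exact hu u.2
  have : PreconnectedSpace H := isPreconnected_iff_preconnectedSpace.1 hconn
  have huniv : ((Γ.subgroupOf H : Subgroup H) : Set H) = Set.univ :=
    IsClopen.eq_univ ⟨Subgroup.isClosed_of_isOpen _ hopen, hopen⟩ ⟨1, one_mem _⟩
  intro u hu
  have : (⟨u, hu⟩ : H) ∈ ((Γ.subgroupOf H : Subgroup H) : Set H) := huniv ▸ Set.mem_univ _
  exact this

end Subgroup

/-! ### Graphs of representations and their radical -/

namespace Subgroup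

open Filter Topology NormedSpace

section Commutative

variable {A : Type*} [NormedRing A] [NormedAlgebra ℝ A] [CompleteSpace A]

/-- The tangent vectors of a commutative subgroup commute with each other. -/
theorem tangent_mul_comm {N : Subgroup Aˣ} (hN : ∀ u ∈ N, ∀ v ∈ N, u * v = v * u) {x y : A}
    (hx : x ∈ N.tangent) (hy : y ∈ N.tangent) : x * y = y * x := by
  have h1 : ∀ t : ℝ, exp (t • x) * y = y * exp (t • x) := fun t => by
    have hy' := hasDerivAt_exp_smul_const y (0 : ℝ)
    simp only [zero_smul, exp_zero, one_mul] at hy'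
    refine (hy'.const_mul (exp (t • x))).unique ?_
    convert! hy'.mul_const (exp (t • x)) using 1
    ext s
    exact congrArg Units.val (hN _ (hx t) _ (hy s))
  have hx' := hasDerivAt_exp_smul_const x (0 : ℝ)
  simp only [zero_smul, exp_zero, one_mul] at hx'
  refine (hx'.mul_const y).unique ?_
  convert! hx'.const_mul y using 1
  ext s
  exact h1 s

theorem _root_.NormedSpace.eq_zero_of_forall_expUnits_eq_one {x : A}
    (hx : ∀ t : ℝ, expUnits (t • x) = 1) : x = 0 := by
  have h := hasDerivAt_exp_smul_const x (0 : ℝ)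
  simp only [zero_smul, exp_zero, one_mul] at h
  refine h.unique ?_
  convert! hasDerivAt_const (0 : ℝ) (1 : A) using 1
  ext t
  exact congrArg Units.val (hx t)

end Commutative

section Graph

variable {B C : Type*} [NormedRing B] [NormedRing C] {G : Subgroup Bˣ}

/-- The graph of a homomorphism between groups of units, as a subgroup of the units of the
product ring. -/
def unitsGraph (ρ : G →* Cˣ) : Subgroup (B × C)ˣ :=
  (MulEquiv.prodUnits.symm.toMonoidHom.comp (G.subtype.prod ρ)).range

theorem isClosed_unitsGraph {ρ : G →* Cˣ} (hρ : Continuous ρ) (hG : IsClosed (G : Set Bˣ)) :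
    IsClosed (unitsGraph ρ : Set (B × C)ˣ) := by
  have h1 : IsClosed {p : G × Cˣ | ρ p.1 = p.2} :=
    isClosed_eq (hρ.comp continuous_fst) continuous_snd
  have h2 : IsClosed (Prod.map Subtype.val id '' {p : G × Cˣ | ρ p.1 = p.2} : Set (Bˣ × Cˣ)) :=
    (hG.isClosedEmbedding_subtypeVal.prodMap .id).isClosedMap _ h1
  convert! h2.preimage (Homeomorph.prodUnits (α := B) (β := C)).continuous using 1
  ext u
  constructor
  · rintro ⟨g, rfl⟩
    exact ⟨(g, ρ g), rfl, rfl⟩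
  · rintro ⟨⟨g, c⟩, h, h'⟩
    refine ⟨g, ?_⟩
    change ρ g = c at h
    subst h
    exact (MulEquiv.symm_apply_eq _).2 h'

theorem isPreconnected_unitsGraph {ρ : G →* Cˣ} (hρ : Continuous ρ)
    (hG : IsPreconnected (G : Set Bˣ)) : IsPreconnected (unitsGraph ρ : Set (B × C)ˣ) := by
  have : PreconnectedSpace G := isPreconnected_iff_preconnectedSpace.1 hG
  exact isPreconnected_range
    ((Homeomorph.prodUnits (α := B) (β := C)).symm.continuous.comp
      (continuous_subtype_val.prodMk hρ))

variable [NormedAlgebra ℝ B] [NormedAlgebra ℝ C] [FiniteDimensional ℝ B] [FiniteDimensional ℝ C]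
  [CompleteSpace B] [CompleteSpace C]

/-- If a connected closed group has no nontrivial connected closed commutative normal subgroup,
then the Lie algebra of the graph of any continuous representation has trivial radical. -/
theorem hasTrivialRadical_unitsGraph {ρ : G →* Cˣ} (hρ : Continuous ρ) (hG : IsClosed (G : Set Bˣ))
    (hconn : IsPreconnected (G : Set Bˣ))
    (hss : ∀ N : Subgroup Bˣ, N ≤ G → (N.subgroupOf G).Normal → IsClosed (N : Set Bˣ) →
      IsConnected (N : Set Bˣ) → (∀ u ∈ N, ∀ v ∈ N, u * v = v * u) → N = ⊥) :
    LieAlgebra.HasTrivialRadical ℝ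
      ((unitsGraph ρ).tangentLieSubalgebra (isClosed_unitsGraph hρ hG)) := by
  set H := unitsGraph ρ with hHdef
  have hH : IsClosed (H : Set (B × C)ˣ) := isClosed_unitsGraph hρ hG
  have hgen := le_closure_expUnits_of_isPreconnected hH (isPreconnected_unitsGraph hρ hconn)
  rw [LieAlgebra.hasTrivialRadical_iff_no_abelian_ideals]
  intro I hI
  let π : (B × C)ˣ →* Bˣ := Units.map (MonoidHom.fst B C)
  have hπ : Continuous π := Units.continuous_map continuous_fst
  have hπH : ∀ u ∈ H, π u ∈ G := by
    rintro _ ⟨g, rfl⟩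
    exact g.2
  have hπ1 : ∀ u ∈ H, π u = 1 → u = 1 := by
    rintro _ ⟨g, rfl⟩ h
    have : g = 1 := Subtype.ext h
    rw [this, map_one]
  let a : Submodule ℝ (B × C) := I.toSubmodule.map (H.tangentLieSubalgebra hH).toSubmodule.subtype
  have haH : ∀ x ∈ a, x ∈ H.tangent := by
    rintro _ ⟨x, -, rfl⟩
    exact x.2
  have hacomm : ∀ x ∈ a, ∀ y ∈ a, Commute x y := by
    rintro _ ⟨x, hx, rfl⟩ _ ⟨y, hy, rfl⟩
    have h := hI.trivial ⟨x, hx⟩ ⟨y, hy⟩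
    have h' : ((x : B × C) * y - y * x) = 0 := congrArg (fun z : I => ((z : _) : B × C)) h
    exact sub_eq_zero.1 h'
  have had : ∀ z ∈ H.tangent, ∀ x ∈ a, z * x - x * z ∈ a := by
    rintro z hz _ ⟨x, hx, rfl⟩
    exact ⟨⁅(⟨z, hz⟩ : H.tangentLieSubalgebra hH), x⁆, I.lie_mem hx, rfl⟩
  have hAd : ∀ u ∈ H, ∀ x ∈ a, (u : B × C) * x * ↑u⁻¹ ∈ a := by
    intro u hu
    -- Carrying both directions makes the inverse step of the closure induction trivial.
    suffices (∀ x ∈ a, (u : B × C) * x * ↑u⁻¹ ∈ a) ∧ ∀ x ∈ a, (↑u⁻¹ : B × C) * x * ↑u ∈ a from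
      this.1
    refine closure_induction (p := fun (u : (B × C)ˣ) _ => (∀ x ∈ a, (u : B × C) * x * ↑u⁻¹ ∈ a) ∧
      ∀ x ∈ a, (↑u⁻¹ : B × C) * x * ↑u ∈ a) ?_ ?_ ?_ ?_ (hgen hu)
    · rintro _ ⟨z, hz, rfl⟩
      refine ⟨fun x hx => expUnits_conj_mem (had z hz) hx, fun x hx => ?_⟩
      have := expUnits_conj_mem (z := -z) (fun y hy => by
        have := a.neg_mem (had z hz y hy)
        convert! this using 1
        noncomm_ring) hx
      rwa [expUnits_neg, inv_inv] at this
    · simp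
    · rintro v w - - ⟨hv, hv'⟩ ⟨hw, hw'⟩
      refine ⟨fun x hx => ?_, fun x hx => ?_⟩
      · have := hv _ (hw x hx)
        simpa [mul_assoc] using this
      · have := hw' _ (hv' x hx)
        simpa [mul_assoc] using this
    · rintro v - ⟨hv, hv'⟩
      exact ⟨fun x hx => by simpa using hv' x hx, fun x hx => by simpa using hv x hx⟩
  -- As `a` is commutative, its exponentials already form a group. The image in `Bˣ` need not be
  -- closed, so its closure is used.
  let S : Subgroup Bˣ :=
    { carrier := (fun x => π (expUnits x)) '' (a : Set (B × C))
      mul_mem' := by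
        rintro _ _ ⟨x, hx, rfl⟩ ⟨y, hy, rfl⟩
        exact ⟨x + y, a.add_mem hx hy, by simp only [expUnits_add (hacomm x hx y hy), map_mul]⟩
      one_mem' := ⟨0, a.zero_mem, by simp⟩
      inv_mem' := by
        rintro _ ⟨x, hx, rfl⟩
        exact ⟨-x, a.neg_mem hx, by simp only [expUnits_neg, map_inv]⟩ }
  have hSG : S.topologicalClosure ≤ G := by
    refine S.topologicalClosure_minimal ?_ hG
    rintro _ ⟨x, hx, rfl⟩
    exact hπH _ (expUnits_mem_of_mem_tangent (haH x hx))
  have hSconn : IsConnected (S.topologicalClosure : Set Bˣ) := by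
    refine IsConnected.closure ⟨⟨1, S.one_mem⟩, ?_⟩
    exact (Submodule.isPathConnected a).isConnected.isPreconnected.image _
      (hπ.comp continuous_expUnits).continuousOn
  have hSnormal : (S.topologicalClosure.subgroupOf G).Normal := by
    refine ⟨fun n hn g => ?_⟩
    change (g : Bˣ) * n * (g : Bˣ)⁻¹ ∈ S.topologicalClosure
    refine map_mem_closure (f := fun v : Bˣ => (g : Bˣ) * v * (g : Bˣ)⁻¹) (by fun_prop) hn ?_
    rintro _ ⟨x, hx, rfl⟩
    -- Conjugation by `g` lifts to conjugation by `(g, ρ g)`, which preserves `a`.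
    have hu : MulEquiv.prodUnits.symm ((g : Bˣ), ρ g) ∈ H := ⟨g, rfl⟩
    refine ⟨_, hAd _ hu x hx, ?_⟩
    simp only [expUnits_conj, map_mul, map_inv]
    rfl
  have hScomm : ∀ u ∈ S.topologicalClosure, ∀ v ∈ S.topologicalClosure, u * v = v * u := by
    have hSS : ∀ u ∈ S, ∀ v ∈ S, u * v = v * u := by
      rintro _ ⟨x, hx, rfl⟩ _ ⟨y, hy, rfl⟩
      simp only [← map_mul, ← expUnits_add (hacomm x hx y hy),
        ← expUnits_add (hacomm y hy x hx), add_comm]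
    have h1 : (S.topologicalClosure : Set Bˣ) ⊆ Set.centralizer S :=
      closure_minimal (fun u hu v hv => hSS v hv u hu) (Set.isClosed_centralizer _)
    have h2 : (S.topologicalClosure : Set Bˣ) ⊆ Set.centralizer S.topologicalClosure :=
      closure_minimal (fun u hu v hv => (h1 hv u hu).symm) (Set.isClosed_centralizer _)
    exact fun u hu v hv => h2 hv u hu
  have hbot := hss _ hSG hSnormal S.isClosed_topologicalClosure hSconn hScomm
  rw [LieSubmodule.eq_bot_iff]
  intro x hx
  have hxa : (x : B × C) ∈ a := ⟨x, hx, rfl⟩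
  refine Subtype.ext (eq_zero_of_forall_expUnits_eq_one fun t => ?_)
  refine hπ1 _ (x.2 t) ?_
  have : π (expUnits (t • (x : B × C))) ∈ S.topologicalClosure :=
    S.le_topologicalClosure ⟨_, a.smul_mem t hxa, rfl⟩
  rwa [hbot, mem_bot] at this

end Graph

end Subgroup

/-! ### Complete reducibility for matrix groups -/

open NormedSpace

namespace MatrixLie

attribute [local instance] Matrix.linftyOpNormedRing Matrix.linftyOpNormedAlgebra

theorem lieAlgebra_eq_tangent {n : ℕ} (N : Subgroup (GL (Fin n) ℝ)) :
    lieAlgebra N = Subgroup.tangent (A := Matrix (Fin n) (Fin n) ℝ) N := by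
  ext x
  refine forall_congr' fun t => ⟨?_, fun h => ⟨_, h, rfl⟩⟩
  rintro ⟨g, hg, h⟩
  have : g = expUnits (t • x) := Units.ext h
  rwa [← this]

theorem isSolvableLie_of_comm {n : ℕ} {N : Subgroup (GL (Fin n) ℝ)}
    (hN : ∀ u ∈ N, ∀ v ∈ N, u * v = v * u) : IsSolvableLie N := by
  refine ⟨1, ?_⟩
  rw [lieDerivedSeries, ← Submodule.bot_coe (R := ℝ), SetLike.coe_set_eq, Submodule.span_eq_bot]
  rintro _ ⟨x, hx, y, hy, rfl⟩
  rw [lieDerivedSeries, lieAlgebra_eq_tangent] at hx hy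
  exact sub_eq_zero.2 (Subgroup.tangent_mul_comm (A := Matrix (Fin n) (Fin n) ℝ) hN hx hy)

end MatrixLie

/-- A connected closed group of units whose Lie algebra has trivial radical acts completely
reducibly on every finite-dimensional complex representation of the ambient algebra. -/
theorem Subgroup.exists_isCompl_of_hasTrivialRadical {A : Type*} [NormedRing A] [NormedAlgebra ℝ A]
    [FiniteDimensional ℝ A] [CompleteSpace A] {d : ℕ} {H : Subgroup Aˣ}
    (hH : IsClosed (H : Set Aˣ)) (hconn : IsPreconnected (H : Set Aˣ))
    [LieAlgebra.HasTrivialRadical ℝ (H.tangentLieSubalgebra hH)]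
    (f : A →ₐ[ℝ] Matrix (Fin d) (Fin d) ℂ) (V : Submodule ℂ (Fin d → ℂ))
    (hV : ∀ u ∈ H, ∀ v ∈ V, f u *ᵥ v ∈ V) :
    ∃ W : Submodule ℂ (Fin d → ℂ), (∀ u ∈ H, ∀ v ∈ W, f u *ᵥ v ∈ W) ∧ IsCompl V W := by
  let _ : NormedRing (Matrix (Fin d) (Fin d) ℂ) := Matrix.linftyOpNormedRing
  let _ : NormedAlgebra ℝ (Matrix (Fin d) (Fin d) ℂ) := Matrix.linftyOpNormedAlgebra
  let L := H.tangentLieSubalgebra hH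
  let _ : LieRingModule L (Fin d → ℂ) :=
    { bracket := fun x m => f (x : A) *ᵥ m
      add_lie := fun x y m => by
        change f ((x : A) + y) *ᵥ m = _
        rw [map_add, Matrix.add_mulVec]
      lie_add := fun x m m' => Matrix.mulVec_add _ _ _
      leibniz_lie := fun x y m => by
        change f (x : A) *ᵥ (f (y : A) *ᵥ m) =
          f ((x : A) * y - y * x) *ᵥ m + f (y : A) *ᵥ (f (x : A) *ᵥ m)
        rw [map_sub, map_mul, map_mul, Matrix.sub_mulVec, Matrix.mulVec_mulVec,
          Matrix.mulVec_mulVec, sub_add_cancel] }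
  have hlie : ∀ (x : L) (m : Fin d → ℂ), ⁅x, m⁆ = f (x : A) *ᵥ m := fun _ _ => rfl
  have : LieModule ℝ L (Fin d → ℂ) :=
    { smul_lie := fun t x m => by
        change f (t • (x : A)) *ᵥ m = t • (f (x : A) *ᵥ m)
        rw [map_smul, Matrix.smul_mulVec]
      lie_smul := fun t x m => Matrix.mulVec_smul _ _ _ }
  let evalAt : (Fin d → ℂ) → A →L[ℝ] (Fin d → ℂ) := fun m => LinearMap.toContinuousLinearMap
    { toFun := fun a => f a *ᵥ m
      map_add' := fun a b => by rw [map_add, Matrix.add_mulVec]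
      map_smul' := fun t a => by rw [map_smul, Matrix.smul_mulVec]; rfl }
  have hLV : ∀ (x : L), ∀ v ∈ V, ⁅x, v⁆ ∈ V := fun x v hv => by
    have h := (evalAt v).hasFDerivAt.comp_hasDerivAt (0 : ℝ)
      (hasDerivAt_exp_smul_const (x : A) (0 : ℝ))
    simp only [zero_smul, exp_zero, one_mul] at h
    exact h.mem_of_forall_mem (S := V.restrictScalars ℝ)
      (V.restrictScalars ℝ).closed_of_finiteDimensional fun t => hV _ (x.2 t) v hv
  let V' : LieSubmodule ℝ L (Fin d → ℂ) :=
    { V.restrictScalars ℝ with lie_mem := fun {x v} hv => hLV x v hv }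
  -- Trivial radical in characteristic zero supplies the nondegenerate Killing form. `P` is only
  -- real linear; `Q` averages it over multiplication by `i`.
  obtain ⟨P, hPL, hPV, hPv⟩ := LieModule.exists_equivariant_projection V'
  let Q : (Fin d → ℂ) →ₗ[ℂ] (Fin d → ℂ) :=
    { toFun := fun m => (2⁻¹ : ℂ) • (P m - Complex.I • P (Complex.I • m))
      map_add' := fun m m' => by simp only [smul_add, map_add]; module
      map_smul' := fun c m => by
        have hc : ∀ w : Fin d → ℂ, c • w = c.re • w + c.im • (Complex.I • w) := fun w => by
          rw [← Complex.coe_smul, ← Complex.coe_smul, smul_smul, ← add_smul, Complex.re_add_im]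
        have hI : ∀ w : Fin d → ℂ, Complex.I • (Complex.I • w) = -w := fun w => by
          rw [smul_smul, Complex.I_mul_I, neg_one_smul]
        have h1 : P (c • m) = c.re • P m + c.im • P (Complex.I • m) := by
          rw [hc m, map_add, P.map_smul c.re, P.map_smul c.im]
        have h2 : P (Complex.I • c • m) = c.re • P (Complex.I • m) - c.im • P m := by
          rw [smul_comm, hc (Complex.I • m), hI, map_add, P.map_smul c.re, P.map_smul c.im, map_neg,
            smul_neg,
            sub_eq_add_neg]
        rw [RingHom.id_apply, h1, h2, smul_comm c, hc (P m - _), smul_sub Complex.I (P m), hI]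
        congr 1
        simp only [smul_sub, smul_comm Complex.I (_ : ℝ)]
        module }
  have hQ : ∀ m, Q m = (2⁻¹ : ℂ) • (P m - Complex.I • P (Complex.I • m)) := fun _ => rfl
  have hQV : ∀ m, Q m ∈ V := fun m =>
    V.smul_mem _ (V.sub_mem (hPV m) (V.smul_mem _ (hPV _)))
  have hQv : ∀ v ∈ V, Q v = v := fun v hv => by
    rw [hQ, hPv v hv, hPv _ (V.smul_mem _ hv), smul_smul, Complex.I_mul_I, neg_one_smul]
    module
  have hQL : ∀ (x : L) m, Q (f (x : A) *ᵥ m) = f (x : A) *ᵥ Q m := fun x m => by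
    rw [hQ, hQ, ← Matrix.mulVec_smul, ← hlie, ← hlie, hPL, hPL, hlie, hlie, Matrix.mulVec_smul,
      Matrix.mulVec_sub, Matrix.mulVec_smul]
  let q := LinearMap.toMatrix' Q
  have hq : ∀ m, q *ᵥ m = Q m := fun m => LinearMap.toMatrix'_mulVec Q m
  have hcomm : ∀ u ∈ H, Commute q (Units.map (f : A →* Matrix (Fin d) (Fin d) ℂ) u :
      (Matrix (Fin d) (Fin d) ℂ)ˣ) := by
    intro u hu
    refine Subgroup.closure_induction (p := fun (u : Aˣ) _ => Commute q
      (Units.map (f : A →* Matrix (Fin d) (Fin d) ℂ) u : (Matrix (Fin d) (Fin d) ℂ)ˣ))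
      ?_ ?_ ?_ ?_ (Subgroup.le_closure_expUnits_of_isPreconnected hH hconn hu)
    · rintro _ ⟨x, hx, rfl⟩
      have h1 : Commute q (f x) := Matrix.ext_of_mulVec_single fun i => by
        rw [← Matrix.mulVec_mulVec, ← Matrix.mulVec_mulVec, hq, hq]
        exact hQL ⟨x, hx⟩ _
      have h2 : f (exp x) = exp (f x) := by
        let _ := NormedAlgebra.restrictScalars ℚ ℝ A
        let _ := NormedAlgebra.restrictScalars ℚ ℝ (Matrix (Fin d) (Fin d) ℂ)
        exact map_exp f f.toLinearMap.continuous_of_finiteDimensional x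
      change Commute q (f (exp x))
      rw [h2]
      exact h1.exp_right
    · simp
    · rintro v w - - hv hw
      rw [map_mul]
      exact hv.mul_right hw
    · rintro v - hv
      rw [map_inv]
      exact hv.units_inv_right
  refine ⟨LinearMap.ker Q, fun u hu w hw => ?_, ?_⟩
  · have h : q * f u = f u * q := hcomm u hu
    rw [LinearMap.mem_ker] at hw ⊢
    rw [← hq, Matrix.mulVec_mulVec, h, ← Matrix.mulVec_mulVec, hq, hw, Matrix.mulVec_zero]
  · have := LinearMap.isCompl_of_proj (f := Q.codRestrict V hQV)
      fun v => Subtype.ext (hQv v v.2)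
    rwa [LinearMap.ker_codRestrict] at this

/-- A representation of `G` is a continuous homomorphism `ρ : G → GL_d(ℂ)`. -/
theorem mainTheorem5 {n d : ℕ} (G : Subgroup (GL (Fin n) ℝ))
    (hG : MatrixLie.IsLieGroup G) (hconn : IsConnected (G : Set (GL (Fin n) ℝ)))
    (hss : MatrixLie.IsSemisimple G) (ρ : G →ₜ* GL (Fin d) ℂ)
    (V : Submodule ℂ (Fin d → ℂ)) (hV : MatrixLie.IsInvariant ρ V) :
    ∃ W : Submodule ℂ (Fin d → ℂ), MatrixLie.IsInvariant ρ W ∧ IsCompl V W := by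
  let _ : NormedRing (Matrix (Fin n) (Fin n) ℝ) := Matrix.linftyOpNormedRing
  let _ : NormedAlgebra ℝ (Matrix (Fin n) (Fin n) ℝ) := Matrix.linftyOpNormedAlgebra
  let _ : NormedRing (Matrix (Fin d) (Fin d) ℂ) := Matrix.linftyOpNormedRing
  let _ : NormedAlgebra ℝ (Matrix (Fin d) (Fin d) ℂ) := Matrix.linftyOpNormedAlgebra
  have hρ : Continuous (ρ : G →* GL (Fin d) ℂ) := ρ.continuous_toFun
  have hH := Subgroup.isClosed_unitsGraph hρ hG
  have hrad := Subgroup.hasTrivialRadical_unitsGraph hρ hG hconn.isPreconnected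
    fun N h1 h2 h3 h4 h5 => hss N h1 h2 h3 h4 (MatrixLie.isSolvableLie_of_comm h5)
  obtain ⟨W, hW, hVW⟩ := Subgroup.exists_isCompl_of_hasTrivialRadical hH
    (Subgroup.isPreconnected_unitsGraph hρ hconn.isPreconnected)
    -- On the graph, the second projection is `ρ`.
    (AlgHom.snd ℝ (Matrix (Fin n) (Fin n) ℝ) (Matrix (Fin d) (Fin d) ℂ)) V (by
      rintro _ ⟨g, rfl⟩ v hv
      exact hV g v hv)
  exact ⟨W, fun g => hW _ ⟨g, rfl⟩, hVW⟩
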